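/- Let $1<p<\infty$. Define the Haar functions on $[0,1]$ by $h_0\equiv 1$ and, for $i=2^n+k$ with $n\ge 0$ and $0\le k<2^n$, by $h_i=1$ on $[k/2^n,(2k+1)/2^{n+1})$, $h_i=-1$ on $[(2k+1)/2^{n+1},(k+1)/2^n)$ and $h_i=0$ elsewhere. Let $h_i^{(p)}=h_i/\|h_i\|_p$ be the normalized Haar basis of the real space $L_p[0,1]$. For a finite dictionary $\mathcal D$ of unit vectors spanning a finite-dimensional real normed space $X$, a greedy algorithm starts from an initial vector $x_0\in X$ and, as long as the residual $x_{n-1}$ is nonzero, selects an element $\varphi_n\in\mathcal D$ by a selection rule, chooses $\lambda_n\in\mathbb R$ minimizing $\lambda\mapsto\|x_{n-1}-\lambda\varphi_n\|$, and sets $x_n=x_{n-1}-\lambda_n\varphi_n$. In the $X$-Greedy Algorithm (XGA), $\varphi_n$ is any $\varphi\in\mathcal D$ for which $\min_{\lambda\in\mathbb R}\|x_{n-1}-\lambda\varphi\|$ is smallest among all elements of $\mathcal D$. In the Dual Greedy Algorithm (DGA), $\varphi_n$ is any $\varphi\in\mathcal D$ for which $|F(\varphi)|$ is largest among all elements of $\mathcal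 D$, where $F\in X^*$ is a norming functional of $x_{n-1}$, i.e. $\|F\|_{X^*}=1$ and $F(x_{n-1})=\|x_{n-1}\|$. The algorithm terminates in at most $N$ iterations from $x_0$ if, whatever admissible choices are made, each step can be carried out and the residual $0$ is reached after at most $N$ iterations. Then for each integer $m\ge 0$ there exists a positive integer $N(p,m)$, depending only on $p$ and $m$, such that, for the dictionary $(h_i^{(p)})_{i=0}^m$ in its linear span $X\subset L_p[0,1]$ (with the norm $\|\cdot\|_p$), both the XGA and the DGA terminate in at most $N(p,m)$ iterations for every initial vector $x_0\in X$. -/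

import Mathlib

open MeasureTheory
open scoped ENNReal

noncomputable section

/-! ### Greedy algorithms in a real normed space -/

section Greedy

/-- `F` is a norming functional for `y`: `‖F‖ = 1` and `F y = ‖y‖`. -/
def IsNormingFunctional {X : Type*} [NormedAddCommGroup X] [NormedSpace ℝ X]
    (F : X →L[ℝ] ℝ) (y : X) : Prop :=
  ‖F‖ = 1 ∧ F y = ‖y‖

/-- The selection rule of the `X`-greedy algorithm for the dictionary `D`: the element `φ` of `D`
may be selected at `y` if the minimum over `a` of `‖y - a • φ‖` is the minimum over all `ψ ∈ D`
and all scalars `b` of `‖y - b • ψ‖`. -/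
def XGASelects {X : Type*} [NormedAddCommGroup X] [NormedSpace ℝ X]
    (D : Set X) (y φ : X) : Prop :=
  φ ∈ D ∧ ∃ a : ℝ, ∀ ψ ∈ D, ∀ b : ℝ, ‖y - a • φ‖ ≤ ‖y - b • ψ‖

/-- The selection rule of the dual greedy algorithm for the dictionary `D`: the element `φ` of `D`
may be selected at `y` if it maximizes `|F ψ|` over `ψ ∈ D`, where `F` is a norming functional
for `y`. -/
def DGASelects {X : Type*} [NormedAddCommGroup X] [NormedSpace ℝ X]
    (D : Set X) (y φ : X) : Prop :=
  φ ∈ D ∧ ∃ F : X →L[ℝ] ℝ, IsNormingFunctional F y ∧ ∀ ψ ∈ D, |F ψ| ≤ |F φ|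

/-- `z` is a possible outcome of the greedy step applied to the residual `y`: select an admissible
`φ`, then choose a scalar `a` that minimizes `‖y - a • φ‖`, and put `z = y - a • φ`. -/
def GreedyStep {X : Type*} [NormedAddCommGroup X] [NormedSpace ℝ X]
    (selects : X → X → Prop) (y z : X) : Prop :=
  ∃ φ : X, ∃ a : ℝ, selects y φ ∧ (∀ b : ℝ, ‖y - a • φ‖ ≤ ‖y - b • φ‖) ∧ z = y - a • φ

/-- `x 0, …, x n` are the residuals of a run of `n` iterations of the algorithm from `x₀`; the
greedy step is applied to nonzero residuals only. -/
def IsGreedyRun {X : Type*} [NormedAddCommGroup X] [NormedSpace ℝ X]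
    (selects : X → X → Prop) (x₀ : X) (n : ℕ) (x : ℕ → X) : Prop :=
  x 0 = x₀ ∧ ∀ k < n, x k ≠ 0 ∧ GreedyStep selects (x k) (x (k + 1))

/-- The algorithm terminates in at most `N` iterations from the initial vector `x₀`, whichever
admissible choices are made: a run whose last residual is nonzero can always be continued,
and no run has more than `N` iterations. (So every run that is carried on as long as possible
reaches the residual `0`, after at most `N` iterations.) -/
def TerminatesWithin {X : Type*} [NormedAddCommGroup X] [NormedSpace ℝ X]
    (selects : X → X → Prop) (N : ℕ) (x₀ : X) : Prop :=
  ∀ (n : ℕ) (x : ℕ → X), IsGreedyRun selects x₀ n x →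
    n ≤ N ∧ (x n ≠ 0 → ∃ z : X, GreedyStep selects (x n) z)

end Greedy

/-! ### The Haar basis of `L_p[0,1]` -/

section Haar

/-- The function equal to `1` on `[k/2^n, (2k+1)/2^(n+1))`, to `-1` on
`[(2k+1)/2^(n+1), (k+1)/2^n)`, and to `0` elsewhere. -/
def dyadicHaar (n k : ℕ) (t : ℝ) : ℝ :=
  if t ∈ Set.Ico ((k : ℝ) / 2 ^ n) ((2 * k + 1 : ℝ) / 2 ^ (n + 1)) then 1
  else if t ∈ Set.Ico ((2 * k + 1 : ℝ) / 2 ^ (n + 1)) ((k + 1 : ℝ) / 2 ^ n) then -1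
  else 0

/-- The Haar functions: `h₀ = 1`, and `h_i` is `dyadicHaar n k` for `i = 2 ^ n + k` with
`0 ≤ k < 2 ^ n`, that is, `n = ⌊log₂ i⌋`. -/
def haarFun (i : ℕ) (t : ℝ) : ℝ :=
  if i = 0 then 1 else dyadicHaar (Nat.log 2 i) (i - 2 ^ Nat.log 2 i) t

/-- Lebesgue measure on `[0,1]`. -/
abbrev volume01 : Measure ℝ := volume.restrict (Set.Icc (0 : ℝ) 1)

theorem measurable_haarFun (i : ℕ) : Measurable (haarFun i) := by
  unfold haarFun
  split_ifs
  · exact measurable_const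
  · unfold dyadicHaar
    exact Measurable.ite measurableSet_Ico measurable_const
      (Measurable.ite measurableSet_Ico measurable_const measurable_const)

theorem norm_haarFun_le (i : ℕ) (t : ℝ) : ‖haarFun i t‖ ≤ 1 := by
  unfold haarFun dyadicHaar
  split_ifs <;> simp

theorem memLp_haarFun (p : ℝ≥0∞) (i : ℕ) : MemLp (haarFun i) p volume01 :=
  MemLp.of_bound (measurable_haarFun i).aestronglyMeasurable 1
    (Filter.Eventually.of_forall (norm_haarFun_le i))

/-- The normalized Haar function `h_i / ‖h_i‖_p` as an element of `L_p[0,1]`. -/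
def haarLp (p : ℝ≥0∞) (i : ℕ) : Lp ℝ p volume01 :=
  ‖(memLp_haarFun p i).toLp (haarFun i)‖⁻¹ • (memLp_haarFun p i).toLp (haarFun i)

/-- The linear span of `h_0, …, h_m`, with the norm of `L_p[0,1]`. -/
abbrev haarSpan (p : ℝ≥0∞) (m : ℕ) : Submodule ℝ (Lp ℝ p volume01) :=
  Submodule.span ℝ (haarLp p '' Set.Iic m)

/-- The normalized Haar functions with indices `0, …, m`, as a dictionary for their span. -/
def haarDictionary (p : ℝ≥0∞) (m : ℕ) : Set (haarSpan p m) :=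
  {φ | ∃ i ≤ m, (φ : Lp ℝ p volume01) = haarLp p i}

end Haar

end

/-! Write each residual as `∑ c_j h_j`. Two facts give termination. (a) Right after a step along
`h_i` the norm is minimal in that direction, and this forces `|c_i| ≤ ∑_{j>i} |c_j|`
(`abs_coeff_le_of_integral_le`). Indeed the `h_j` with `j < i` are constant on the support of `h_i`,
so the sum there is `K ± c_i` up to a tail bounded by the right-hand side; if `|c_i|` exceeded that
bound, shrinking it would lower the norm by strict convexity of `|x|^p`. (b) Each step shrinks the
norm by a uniform factor `θ < 1`. The `p`-th power of the norm is differentiable along each `h_i`,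
so a norming functional with `F φ ≠ 0` yields a strict decrease along `φ`. Compactness makes this
uniform for the DGA (`exists_dga_contraction`), and an XGA step is at least as good as a DGA step.
The rest is combinatorial (`IsTriangularRun.exists_length_le`). If every index of a set `B` keeps
being picked, (a) bounds all coordinates by those outside `B`. The latter are frozen, so the norm
cannot decay far, against (b). Hence long runs must neglect some index for long, and induction on
the size of `B` applies. -/

/-! ### Combinatorics of triangular runs. -/

/-- Coordinates changed one at a time, each new value being dominated by the coordinates of larger
index, while a size comparable with the norm decreases geometrically. -/
structure IsTriangularRun {n : ℕ} (s : (Fin n → ℝ) → ℝ) (θ : ℝ) (B : Finset (Fin n)) (T : ℕ)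
    (c : ℕ → Fin n → ℝ) (pick : ℕ → Fin n) : Prop where
  pick_mem : ∀ t < T, pick t ∈ B
  eq_of_ne : ∀ t < T, ∀ j, j ≠ pick t → c (t + 1) j = c t j
  abs_le : ∀ t < T, |c (t + 1) (pick t)| ≤ ∑ j ∈ Finset.Ioi (pick t), |c (t + 1) j|
  size_le : ∀ t < T, s (c (t + 1)) ≤ θ * s (c t)
  size_pos : ∀ t < T, 0 < s (c t)

namespace IsTriangularRun

variable {n : ℕ} {s : (Fin n → ℝ) → ℝ} {θ : ℝ} {B : Finset (Fin n)} {T : ℕ}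
  {c : ℕ → Fin n → ℝ} {pick : ℕ → Fin n}

theorem window (h : IsTriangularRun s θ B T c pick) {a L : ℕ} (haL : a + L ≤ T)
    {B' : Finset (Fin n)} (hB' : ∀ t < L, pick (a + t) ∈ B') :
    IsTriangularRun s θ B' L (fun t => c (a + t)) (fun t => pick (a + t)) where
  pick_mem := hB'
  eq_of_ne t ht := h.eq_of_ne (a + t) (by omega)
  abs_le t ht := h.abs_le (a + t) (by omega)
  size_le t ht := h.size_le (a + t) (by omega)
  size_pos t ht := h.size_pos (a + t) (by omega)

theorem eq_zero_time (h : IsTriangularRun s θ B T c pick) {j : Fin n} (hj : j ∉ B) :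
    ∀ t ≤ T, c t j = c 0 j := by
  intro t
  induction t with
  | zero => intro; rfl
  | succ t ih =>
    intro ht
    rw [h.eq_of_ne t ht j (fun hjp => hj (hjp ▸ h.pick_mem t ht)), ih (by omega)]

theorem size_le_pow (h : IsTriangularRun s θ B T c pick) (hθ : 0 ≤ θ) (a : ℕ) :
    ∀ t, a + t ≤ T → s (c (a + t)) ≤ θ ^ t * s (c a) := by
  intro t
  induction t with
  | zero => intro; simp
  | succ t ih =>
    intro ht
    calc s (c (a + (t + 1))) ≤ θ * s (c (a + t)) := h.size_le (a + t) (by omega)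
      _ ≤ θ * (θ ^ t * s (c a)) := by gcongr; exact ih (by omega)
      _ = _ := by ring

/-- If every window of length `L` picks all of `B`, then after `r` windows the last `r` coordinates
are dominated by those outside `B`. -/
theorem abs_le_of_windows (h : IsTriangularRun s θ B T c pick) {L : ℕ} {V : ℝ} (hV : 0 ≤ V)
    (hout : ∀ j ∉ B, |c 0 j| ≤ V)
    (hwin : ∀ a, a + L ≤ T → ∀ i ∈ B, ∃ t < L, pick (a + t) = i) (r : ℕ) :
    ∀ t, r * L ≤ t → t ≤ T → ∀ i : Fin n, n ≤ i + r → |c t i| ≤ (n : ℝ) ^ r * V := by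
  induction r with
  | zero => intro t _ _ i hi; omega
  | succ r ih =>
    intro t hrt htT i hi
    have hn : (1 : ℝ) ≤ n := by exact_mod_cast (Nat.one_le_iff_ne_zero.2 (by have := i.2; omega))
    by_cases hiB : i ∈ B
    · have key : ∀ u, r * L ≤ u → u < T → pick u = i → |c (u + 1) i| ≤ (n : ℝ) ^ (r + 1) * V := by
        intro u hu huT hui
        have h1 := h.abs_le u huT
        rw [hui] at h1
        calc |c (u + 1) i| ≤ ∑ j ∈ Finset.Ioi i, |c (u + 1) j| := h1
          _ ≤ ∑ j ∈ Finset.Ioi i, (n : ℝ) ^ r * V := by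
              refine Finset.sum_le_sum fun j hj => ih (u + 1) (by omega) (by omega) j ?_
              have := Fin.lt_def.1 (Finset.mem_Ioi.1 hj)
              omega
          _ ≤ ∑ j : Fin n, (n : ℝ) ^ r * V :=
              Finset.sum_le_sum_of_subset_of_nonneg (Finset.subset_univ _)
                fun _ _ _ => by positivity
          _ = (n : ℝ) ^ (r + 1) * V := by simp; ring
      rw [Nat.succ_mul] at hrt
      obtain ⟨u, huL, hui⟩ := hwin (r * L) (by omega) i hiB
      -- Once `i` has been picked in this window the bound persists: the coordinate is unchanged
      -- between picks, and each new pick restores the bound.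
      have : ∀ v, r * L + u + 1 + v ≤ T → |c (r * L + u + 1 + v) i| ≤ (n : ℝ) ^ (r + 1) * V := by
        intro v
        induction v with
        | zero => intro hv; exact key _ (by omega) (by omega) hui
        | succ v ihv =>
          intro hv
          by_cases hp : pick (r * L + u + 1 + v) = i
          · exact key (r * L + u + 1 + v) (by omega) (by omega) hp
          · rw [show r * L + u + 1 + (v + 1) = (r * L + u + 1 + v) + 1 by ring,
              h.eq_of_ne _ (by omega) i (Ne.symm hp)]
            exact ihv (by omega)
      have h2 := this (t - (r * L + u + 1)) (by omega)
      rwa [show r * L + u + 1 + (t - (r * L + u + 1)) = t by omega] at h2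
    · rw [h.eq_zero_time hiB t htT]
      calc |c 0 i| ≤ V := hout i hiB
        _ ≤ (n : ℝ) ^ (r + 1) * V := le_mul_of_one_le_left hV (one_le_pow₀ hn)

/-- Induction on the number of indices that may be picked; `s` is only required to be comparable
with the sup norm. -/
theorem exists_length_le (s : (Fin n → ℝ) → ℝ) {θ α β : ℝ} (hθ0 : 0 ≤ θ) (hθ1 : θ < 1)
    (hα : 0 < α) (hβ : 0 ≤ β) (hlow : ∀ v, α * ‖v‖ ≤ s v) (hupp : ∀ v, s v ≤ β * ‖v‖) (b : ℕ) :
    ∃ N : ℕ, ∀ (B : Finset (Fin n)) (T : ℕ) (c : ℕ → Fin n → ℝ) (pick : ℕ → Fin n),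
      B.card ≤ b → IsTriangularRun s θ B T c pick → T ≤ N := by
  induction b with
  | zero =>
    refine ⟨0, fun B T c pick hB h => ?_⟩
    by_contra hT
    have := h.pick_mem 0 (by omega)
    simp_all
  | succ b ih =>
    obtain ⟨N, hN⟩ := ih
    set A : ℝ := (n : ℝ) ^ n
    -- After `M` further steps the decay beats the loss `β * A / α` from comparing norms and from
    -- the domination.
    obtain ⟨M, hM⟩ : ∃ M : ℕ, θ ^ M * (β * A) < α := by
      have : Filter.Tendsto (fun M : ℕ => θ ^ M * (β * A)) Filter.atTop (nhds (0 * (β * A))) :=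
        (tendsto_pow_atTop_nhds_zero_of_lt_one hθ0 hθ1).mul_const _
      rw [zero_mul] at this
      exact (this.eventually (gt_mem_nhds hα)).exists
    refine ⟨n * (N + 1) + M, fun B T c pick hB h => ?_⟩
    by_contra hT
    -- A window of length `N + 1` that misses `i` would be a run on `B.erase i`, longer than the
    -- induction hypothesis allows.
    have hwin : ∀ a, a + (N + 1) ≤ T → ∀ i ∈ B, ∃ t < N + 1, pick (a + t) = i := by
      intro a ha i hi
      by_contra! hne
      have := hN (B.erase i) (N + 1) _ _ (by rw [Finset.card_erase_of_mem hi]; omega)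
        (h.window ha fun t ht => Finset.mem_erase.2 ⟨hne t ht, h.pick_mem _ (by omega)⟩)
      omega
    -- The frozen part: it dominates the vector at time `k` and bounds every later vector from
    -- below.
    set w : Fin n → ℝ := fun j => if j ∈ B then 0 else c 0 j
    have hout : ∀ j ∉ B, |c 0 j| ≤ ‖w‖ := by
      intro j hj
      simpa [w, hj] using norm_le_pi_norm w j
    set k := n * (N + 1)
    have h1 : ‖c k‖ ≤ A * ‖w‖ :=
      (pi_norm_le_iff_of_nonneg (by positivity)).2 fun i =>
        h.abs_le_of_windows (norm_nonneg w) hout hwin n k le_rfl (by omega) i (by omega)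
    have h2 : ‖w‖ ≤ ‖c (k + M)‖ := by
      refine (pi_norm_le_iff_of_nonneg (norm_nonneg _)).2 fun j => ?_
      by_cases hj : j ∈ B
      · simp [w, hj]
      · simpa [w, hj, h.eq_zero_time hj (k + M) (by omega)] using norm_le_pi_norm (c (k + M)) j
    have h3 := h.size_le_pow hθ0 k M (by omega)
    have h4 := h.size_pos k (by omega)
    have h5 : α * s (c k) ≤ θ ^ M * (β * A) * s (c k) :=
      calc α * s (c k) ≤ α * (β * (A * ‖c (k + M)‖)) := by
            gcongr
            exact (hupp _).trans (by gcongr; exact h1.trans (by gcongr))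
        _ = β * A * (α * ‖c (k + M)‖) := by ring
        _ ≤ β * A * (θ ^ M * s (c k)) := 
            mul_le_mul_of_nonneg_left ((hlow _).trans h3) (by positivity)
        _ = _ := by ring
    exact absurd h5 (not_le.2 (by gcongr))

end IsTriangularRun

/-! ### Convexity inequalities for `|x| ^ q`. -/

theorem convexOn_abs_rpow {q : ℝ} (hq : 1 ≤ q) :
    ConvexOn ℝ Set.univ fun x : ℝ => |x| ^ q := by
  have himg : (fun x : ℝ => |x|) '' Set.univ ⊆ Set.Ici 0 := by
    rintro _ ⟨x, -, rfl⟩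
    exact abs_nonneg x
  have hconv : Convex ℝ ((fun x : ℝ => |x|) '' Set.univ) := by
    have : (fun x : ℝ => |x|) '' Set.univ = Set.Ici 0 :=
      himg.antisymm fun x hx => ⟨x, trivial, abs_of_nonneg hx⟩
    rw [this]
    exact convex_Ici 0
  exact ConvexOn.comp ((convexOn_rpow hq).subset himg hconv) (convexOn_univ_norm (E := ℝ))
    ((Real.monotoneOn_rpow_Ici_of_exponent_nonneg (by linarith)).mono himg)

theorem two_mul_abs_rpow_lt {q : ℝ} (hq : 1 < q) (K : ℝ) {η : ℝ} (hη : 0 < η) :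
    2 * |K| ^ q < |K + η| ^ q + |K - η| ^ q := by
  -- Strict convexity is used on `[0, ∞)` for the absolute values, so the case where these coincide
  -- (`K = 0`) is separate.
  by_cases hab : |K + η| = |K - η|
  · have hK : K = 0 := by
      rcases abs_eq_abs.1 hab with h | h <;> linarith
    subst hK
    have : 0 < |0 + η| ^ q := Real.rpow_pos_of_pos (abs_pos.2 (by linarith)) q
    have : 0 < |0 - η| ^ q := Real.rpow_pos_of_pos (abs_pos.2 (by linarith)) q
    rw [abs_zero, Real.zero_rpow (by linarith)]
    linarith
  · have h := (strictConvexOn_rpow hq).2 (abs_nonneg (K + η)) (abs_nonneg (K - η)) hab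
      (show (0 : ℝ) < 1 / 2 by norm_num) (show (0 : ℝ) < 1 / 2 by norm_num) (by norm_num)
    have hK : |K| ≤ 1 / 2 * |K + η| + 1 / 2 * |K - η| := by
      have := abs_add_le (K + η) (K - η)
      rw [show K + η + (K - η) = 2 * K by ring, abs_mul, abs_two] at this
      linarith
    have h2 := Real.rpow_le_rpow (abs_nonneg K) hK (show 0 ≤ q by linarith)
    simp only [smul_eq_mul] at h
    linarith

/-- Increments of a convex function over intervals of equal length increase. -/
theorem ConvexOn.increment_le {g : ℝ → ℝ} (hg : ConvexOn ℝ Set.univ g) (K : ℝ) {η s : ℝ}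
    (hη : 0 < η) (hs : η ≤ s) : g (K + η) - g K ≤ g (K + s) - g (K + s - η) := by
  have hs0 : 0 < s := hη.trans_le hs
  have hθ : η / s ≤ 1 := (div_le_one hs0).2 hs
  -- `K + η` and `K + s - η` are convex combinations of `K` and `K + s` with exchanged weights; the
  -- two inequalities are added.
  have h1 := hg.2 (Set.mem_univ K) (Set.mem_univ (K + s)) (sub_nonneg.2 hθ)
    (div_nonneg hη.le hs0.le) (by ring)
  have h2 := hg.2 (Set.mem_univ (K + s)) (Set.mem_univ K) (sub_nonneg.2 hθ)
    (div_nonneg hη.le hs0.le) (by ring)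
  simp only [smul_eq_mul] at h1 h2
  rw [show (1 - η / s) * K + η / s * (K + s) = K + η by field_simp; ring] at h1
  rw [show (1 - η / s) * (K + s) + η / s * K = K + s - η by field_simp; ring] at h2
  linarith

theorem abs_rpow_increment_le {q : ℝ} (hq : 1 ≤ q) {K η y : ℝ} (hη : 0 < η) (hy : K + η ≤ y) :
    |K + η| ^ q - |K| ^ q ≤ |y| ^ q - |y - η| ^ q := by
  have := (convexOn_abs_rpow hq).increment_le K hη (show η ≤ y - K by linarith)
  simpa using this

theorem abs_rpow_decrement_le {q : ℝ} (hq : 1 ≤ q) {K η y : ℝ} (hη : 0 < η) (hy : y ≤ K - η) :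
    |K - η| ^ q - |K| ^ q ≤ |y| ^ q - |y + η| ^ q := by
  have := abs_rpow_increment_le hq (K := -K) (y := -y) hη (by linarith)
  rwa [abs_neg, abs_neg, show -K + η = -(K - η) by ring, show -y - η = -(y + η) by ring,
    abs_neg, abs_neg] at this

/-! ### Level sets of the Haar functions -/

theorem volume01_Ico {a b : ℝ} (ha : 0 ≤ a) (hb : b ≤ 1) :
    volume01.real (Set.Ico a b) = max (b - a) 0 := by
  have hsub : Set.Ico a b ⊆ Set.Icc 0 1 := fun t ht => ⟨ha.trans ht.1, ht.2.le.trans hb⟩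
  rw [Measure.real, Measure.restrict_apply measurableSet_Ico, Set.inter_eq_left.2 hsub,
    Real.volume_Ico, ENNReal.toReal_ofReal']

/-- A dyadic threshold of level at most `n` does not separate points of a dyadic interval of
level `n`. -/
theorem div_two_pow_le_iff {N n k a : ℕ} (hN : N ≤ n) {t : ℝ}
    (ht : t ∈ Set.Ico ((k : ℝ) / 2 ^ n) ((k + 1 : ℝ) / 2 ^ n)) :
    (a : ℝ) / 2 ^ N ≤ t ↔ (a : ℝ) / 2 ^ N ≤ (k : ℝ) / 2 ^ n := by
  refine ⟨fun h => ?_, fun h => h.trans ht.1⟩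
  have h1 : (a : ℝ) / 2 ^ N < (k + 1 : ℝ) / 2 ^ n := h.trans_lt ht.2
  obtain ⟨d, rfl⟩ := Nat.exists_eq_add_of_le hN
  have e : ∀ x : ℝ, x / 2 ^ N = x * 2 ^ d / 2 ^ (N + d) := fun x => by
    rw [pow_add]; field_simp
  rw [e, div_lt_div_iff_of_pos_right (by positivity)] at h1
  rw [e, div_le_div_iff_of_pos_right (by positivity)]
  have h2 : a * 2 ^ d < k + 1 := by exact_mod_cast h1
  exact_mod_cast Nat.lt_succ_iff.1 h2

/-- The breakpoints of `dyadicHaar N l` have level at most `N + 1 ≤ n`. -/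
theorem dyadicHaar_eq_of_lt {N n l k : ℕ} (hN : N < n) {t : ℝ}
    (ht : t ∈ Set.Ico ((k : ℝ) / 2 ^ n) ((k + 1 : ℝ) / 2 ^ n)) :
    dyadicHaar N l t = dyadicHaar N l ((k : ℝ) / 2 ^ n) := by
  have h1 := div_two_pow_le_iff (a := l) hN.le ht
  have h2 := div_two_pow_le_iff (a := 2 * l + 1) hN ht
  have h3 := div_two_pow_le_iff (a := l + 1) hN.le ht
  push_cast at h2 h3
  simp only [dyadicHaar, Set.mem_Ico, ← not_le, h1, h2, h3]

theorem dyadicHaar_eq_zero_of_lt {n l k : ℕ} (hl : l < k) {t : ℝ} (ht : (k : ℝ) / 2 ^ n ≤ t) :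
    dyadicHaar n l t = 0 := by
  have h1 : ((l + 1 : ℕ) : ℝ) / 2 ^ n ≤ t :=
    le_trans (by gcongr; exact_mod_cast hl) ht
  have h2 : (2 * l + 1 : ℝ) / 2 ^ (n + 1) ≤ (l + 1 : ℝ) / 2 ^ n := by
    rw [pow_succ, div_le_div_iff₀ (by positivity) (by positivity)]
    have : (0 : ℝ) < 2 ^ n := by positivity
    nlinarith
  push_cast at h1
  simp only [dyadicHaar, Set.mem_Ico, ← not_le, h1, h2.trans h1]
  simp

/-- The sets on which a Haar function is `1` and `-1`, and the constancy there of the Haar functions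
of smaller index. -/
theorem exists_haarFun_levels (i : ℕ) :
    ∃ P Q : Set ℝ, MeasurableSet P ∧ MeasurableSet Q ∧ 0 < volume01.real P ∧
      ((i = 0 ∧ volume01.real Q = 0) ∨ volume01.real Q = volume01.real P) ∧ Disjoint P Q ∧
      (∀ t ∈ P, haarFun i t = 1) ∧ (∀ t ∈ Q, haarFun i t = -1) ∧
      (∀ t, t ∉ P → t ∉ Q → haarFun i t = 0) ∧
      ∃ κ : ℕ → ℝ, ∀ j < i, ∀ t, t ∈ P ∨ t ∈ Q → haarFun j t = κ j := by
  rcases Nat.eq_zero_or_pos i with rfl | hi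
  · refine ⟨Set.univ, ∅, MeasurableSet.univ, MeasurableSet.empty, ?_, Or.inl ⟨rfl, by simp⟩,
      disjoint_bot_right, ?_, ?_, ?_, fun _ => 0, ?_⟩ <;> simp [haarFun, Measure.real]
  have hi0 : i ≠ 0 := hi.ne'
  set n := Nat.log 2 i with hn
  obtain ⟨k, hk⟩ := Nat.exists_eq_add_of_le (Nat.pow_log_le_self 2 hi0)
  rw [← hn] at hk
  have hk2 : k < 2 ^ n := by
    have := Nat.lt_pow_succ_log_self (b := 2) one_lt_two i
    rw [← hn, pow_succ] at this
    omega
  have hkn : (k + 1 : ℝ) / 2 ^ n ≤ 1 := by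
    rw [div_le_one (by positivity)]
    exact_mod_cast hk2
  have hfun : ∀ t, haarFun i t = dyadicHaar n k t := fun t => by
    rw [haarFun, if_neg hi0, ← hn, hk, Nat.add_sub_cancel_left]
  have e1 : (2 * k + 1 : ℝ) / 2 ^ (n + 1) - k / 2 ^ n = 1 / 2 ^ (n + 1) := by
    rw [pow_succ]; field_simp; ring
  have e2 : (k + 1 : ℝ) / 2 ^ n - (2 * k + 1) / 2 ^ (n + 1) = 1 / 2 ^ (n + 1) := by
    rw [pow_succ]; field_simp; ring
  have hpos : (0 : ℝ) < 1 / 2 ^ (n + 1) := by positivity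
  have hk0 : (0 : ℝ) ≤ k / 2 ^ n := by positivity
  refine ⟨Set.Ico ((k : ℝ) / 2 ^ n) ((2 * k + 1 : ℝ) / 2 ^ (n + 1)),
    Set.Ico ((2 * k + 1 : ℝ) / 2 ^ (n + 1)) ((k + 1 : ℝ) / 2 ^ n), measurableSet_Ico,
    measurableSet_Ico, ?_, Or.inr ?_, ?_, ?_, ?_, ?_,
    fun j => haarFun j ((k : ℝ) / 2 ^ n), ?_⟩
  · rw [volume01_Ico hk0 (by linarith), e1]
    exact lt_max_of_lt_left hpos
  · rw [volume01_Ico hk0 (by linarith), volume01_Ico (by linarith) hkn, e1, e2]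
  · exact Set.Ico_disjoint_Ico_same
  · intro t ht
    rw [hfun, dyadicHaar, if_pos ht]
  · intro t ht
    rw [hfun, dyadicHaar, if_neg (fun h => not_le.2 h.2 ht.1), if_pos ht]
  · intro t hP hQ
    rw [hfun, dyadicHaar, if_neg hP, if_neg hQ]
  · intro j hj t ht
    have htI : t ∈ Set.Ico ((k : ℝ) / 2 ^ n) ((k + 1 : ℝ) / 2 ^ n) := by
      rcases ht with ht | ht
      · exact ⟨ht.1, ht.2.trans_le (by linarith)⟩
      · exact ⟨le_trans (by linarith) ht.1, ht.2⟩
    change haarFun j t = haarFun j ((k : ℝ) / 2 ^ n)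
    unfold haarFun
    split_ifs with hj0
    · rfl
    have hlog : Nat.log 2 j ≤ n := Nat.log_mono_right hj.le
    -- A smaller index means either a coarser level or the same level with an interval further left,
    -- where the function vanishes on `P ∪ Q`.
    rcases hlog.lt_or_eq with hlt | heq
    · exact dyadicHaar_eq_of_lt hlt htI
    · rw [heq]
      have hjn := Nat.pow_log_le_self 2 hj0
      rw [heq] at hjn
      have hl : j - 2 ^ n < k := by omega
      rw [dyadicHaar_eq_zero_of_lt hl htI.1, dyadicHaar_eq_zero_of_lt hl le_rfl]

/-! ### Varying one coefficient of a Haar polynomial. -/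

/-- The linear combination of the first `n` Haar functions with coefficients `c`. -/
noncomputable def haarSum {n : ℕ} (c : Fin n → ℝ) (t : ℝ) : ℝ := ∑ j, c j * haarFun j t

theorem measurable_haarSum {n : ℕ} (c : Fin n → ℝ) : Measurable (haarSum c) := by
  unfold haarSum
  exact Finset.measurable_sum _ fun j _ => (measurable_haarFun j).const_mul _

theorem abs_haarSum_le {n : ℕ} (c : Fin n → ℝ) (t : ℝ) : |haarSum c t| ≤ ∑ j, |c j| := by
  refine (Finset.abs_sum_le_sum_abs _ _).trans (Finset.sum_le_sum fun j _ => ?_)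
  rw [abs_mul]
  exact mul_le_of_le_one_right (abs_nonneg _) (norm_haarFun_le j t)

theorem haarSum_add_single {n : ℕ} (c : Fin n → ℝ) (i : Fin n) (s t : ℝ) :
    haarSum (c + Pi.single i s) t = haarSum c t + s * haarFun i t := by
  simp [haarSum, add_mul, Finset.sum_add_distrib, Pi.single_apply]

theorem haarSum_neg {n : ℕ} (c : Fin n → ℝ) (t : ℝ) : haarSum (-c) t = -haarSum c t := by
  simp [haarSum]

theorem sum_eq_sum_Iio_add_sum_Ioi {n : ℕ} (u : Fin n → ℝ) (i : Fin n) :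
    ∑ j, u j = ∑ j ∈ Finset.Iio i, u j + u i + ∑ j ∈ Finset.Ioi i, u j := by
  have h : (Finset.univ : Finset (Fin n)) = insert i (Finset.Iio i ∪ Finset.Ioi i) := by
    ext j
    simp only [Finset.mem_univ, Finset.mem_insert, Finset.mem_union, Finset.mem_Iio,
      Finset.mem_Ioi, true_iff]
    rcases lt_trichotomy j i with h | h | h <;> simp [h]
  have hd : Disjoint (Finset.Iio i) (Finset.Ioi i) :=
    Finset.disjoint_left.2 fun j h1 h2 =>
      lt_asymm (Finset.mem_Iio.1 h1) (Finset.mem_Ioi.1 h2)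
  rw [h, Finset.sum_insert (by simp), Finset.sum_union hd]
  ring

theorem integrable_abs_rpow_of_bound {f : ℝ → ℝ} (hf : Measurable f) {C : ℝ}
    (hC : ∀ t, |f t| ≤ C) {q : ℝ} (hq : 0 ≤ q) : Integrable (fun t => |f t| ^ q) volume01 := by
  refine Integrable.of_bound (hf.norm.pow_const q).aestronglyMeasurable (C ^ q)
    (Filter.Eventually.of_forall fun t => ?_)
  rw [Real.norm_of_nonneg (by positivity)]
  exact Real.rpow_le_rpow (abs_nonneg _) (hC t) hq

theorem integrable_haarSum_rpow {n : ℕ} (c : Fin n → ℝ) {q : ℝ} (hq : 0 ≤ q) :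
    Integrable (fun t => |haarSum c t| ^ q) volume01 :=
  integrable_abs_rpow_of_bound (measurable_haarSum c) (abs_haarSum_le c) hq

theorem measureReal_mul_add_le_integral_sub {u v : ℝ → ℝ} (hu : Integrable u volume01)
    (hv : Integrable v volume01) {P Q : Set ℝ} (hP : MeasurableSet P) (hQ : MeasurableSet Q)
    {a b : ℝ}
    (h : ∀ t, P.indicator (fun _ => a) t + Q.indicator (fun _ => b) t ≤ u t - v t) :
    volume01.real P * a + volume01.real Q * b ≤ ∫ t, u t ∂volume01 - ∫ t, v t ∂volume01 := by
  have hiP : Integrable (P.indicator fun _ => a) volume01 := (integrable_const a).indicator hP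
  have hiQ : Integrable (Q.indicator fun _ => b) volume01 := (integrable_const b).indicator hQ
  have hint := integral_mono (hiP.add hiQ) (hu.sub hv) h
  rwa [integral_add' hiP hiQ, integral_sub' hu hv, integral_indicator_const _ hP,
    integral_indicator_const _ hQ, smul_eq_mul, smul_eq_mul] at hint

/-- With `η` the excess of `c i` over the tail bound, the sum is at least `K + η` on `P` and at most
`K - η` on `Q`. Lowering `c i` by `η` moves both sets of values towards `K`, and convexity bounds
the gains below by `a` and `b`. -/
theorem exists_indicator_le_sub {n : ℕ} {q : ℝ} (hq : 1 < q) (c : Fin n → ℝ) (i : Fin n)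
    (hlt : ∑ j ∈ Finset.Ioi i, |c j| < c i) :
    ∃ (s : ℝ) (P Q : Set ℝ) (a b : ℝ), MeasurableSet P ∧ MeasurableSet Q ∧
      0 < volume01.real P * a + volume01.real Q * b ∧
      ∀ t, P.indicator (fun _ => a) t + Q.indicator (fun _ => b) t ≤
        |haarSum c t| ^ q - |haarSum (c + Pi.single i s) t| ^ q := by
  set D := ∑ j ∈ Finset.Ioi i, |c j|
  set η := c i - D with hη
  have hη0 : 0 < η := by linarith
  obtain ⟨P, Q, hP, hQ, hPpos, hPQ, hdisj, h1, h2, h3, κ, hκ⟩ := exists_haarFun_levels i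
  set K := ∑ j ∈ Finset.Iio i, c j * κ j with hK
  have hd : ∀ t, |∑ j ∈ Finset.Ioi i, c j * haarFun j t| ≤ D := fun t => by
    refine (Finset.abs_sum_le_sum_abs _ _).trans (Finset.sum_le_sum fun j _ => ?_)
    rw [abs_mul]
    exact mul_le_of_le_one_right (abs_nonneg _) (norm_haarFun_le j t)
  have hval : ∀ t, t ∈ P ∨ t ∈ Q →
      haarSum c t = K + c i * haarFun i t + ∑ j ∈ Finset.Ioi i, c j * haarFun j t := by
    intro t ht
    rw [haarSum, sum_eq_sum_Iio_add_sum_Ioi _ i, hK]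
    congr 2
    exact Finset.sum_congr rfl fun j hj => by
      rw [hκ j (Fin.lt_def.1 (Finset.mem_Iio.1 hj)) t ht]
  set a := |K + η| ^ q - |K| ^ q with ha
  set b := |K - η| ^ q - |K| ^ q with hb
  have hpt : ∀ t, P.indicator (fun _ => a) t + Q.indicator (fun _ => b) t ≤
      |haarSum c t| ^ q - |haarSum (c + Pi.single i (-η)) t| ^ q := by
    intro t
    rw [haarSum_add_single]
    have hdt := abs_le.1 (hd t)
    by_cases htP : t ∈ P
    · have htQ : t ∉ Q := Set.disjoint_left.1 hdisj htP
      have hv := hval t (Or.inl htP)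
      rw [h1 t htP] at hv ⊢
      rw [Set.indicator_of_mem htP, Set.indicator_of_notMem htQ, add_zero,
        show haarSum c t + -η * 1 = haarSum c t - η by ring]
      exact abs_rpow_increment_le hq.le hη0 (by linarith)
    · by_cases htQ : t ∈ Q
      · have hv := hval t (Or.inr htQ)
        rw [h2 t htQ] at hv ⊢
        rw [Set.indicator_of_mem htQ, Set.indicator_of_notMem htP, zero_add,
          show haarSum c t + -η * -1 = haarSum c t + η by ring]
        exact abs_rpow_decrement_le hq.le hη0 (by linarith)
      · rw [Set.indicator_of_notMem htP, Set.indicator_of_notMem htQ, h3 t htP htQ]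
        simp
  refine ⟨-η, P, Q, a, b, hP, hQ, ?_, hpt⟩
  -- For `i = 0` there is no lower index, so `K = 0` and the gain on `P` is `η ^ q`. Otherwise `P`
  -- and `Q` have equal measure and strict convexity gives `a + b > 0`.
  rcases hPQ with ⟨hi0, hQ0⟩ | hQP
  · have hK0 : K = 0 := by
      rw [hK]
      refine Finset.sum_eq_zero fun j hj => absurd (Fin.lt_def.1 (Finset.mem_Iio.1 hj)) ?_
      omega
    rw [hQ0, zero_mul, add_zero, ha, hK0, abs_zero, Real.zero_rpow (by linarith), zero_add,
      sub_zero]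
    exact mul_pos hPpos (Real.rpow_pos_of_pos (abs_pos.2 hη0.ne') q)
  · rw [hQP, ← mul_add]
    exact mul_pos hPpos (by have := two_mul_abs_rpow_lt hq K hη0; linarith)

theorem integral_haarSum_lt {n : ℕ} {q : ℝ} (hq : 0 ≤ q) (c c' : Fin n → ℝ) {P Q : Set ℝ}
    {a b : ℝ} (hP : MeasurableSet P) (hQ : MeasurableSet Q)
    (hpos : 0 < volume01.real P * a + volume01.real Q * b)
    (hpt : ∀ t, P.indicator (fun _ => a) t + Q.indicator (fun _ => b) t ≤
      |haarSum c t| ^ q - |haarSum c' t| ^ q) :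
    ∫ t, |haarSum c' t| ^ q ∂volume01 < ∫ t, |haarSum c t| ^ q ∂volume01 :=
  sub_pos.1 (hpos.trans_le (measureReal_mul_add_le_integral_sub (integrable_haarSum_rpow c hq)
    (integrable_haarSum_rpow c' hq) hP hQ hpt))

theorem coeff_le_of_integral_le {n : ℕ} {q : ℝ} (hq : 1 < q) (c : Fin n → ℝ) (i : Fin n)
    (hmin : ∀ s : ℝ, ∫ t, |haarSum c t| ^ q ∂volume01 ≤
      ∫ t, |haarSum (c + Pi.single i s) t| ^ q ∂volume01) :
    c i ≤ ∑ j ∈ Finset.Ioi i, |c j| := by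
  by_contra! hlt
  obtain ⟨s, P, Q, a, b, hP, hQ, hpos, hpt⟩ := exists_indicator_le_sub hq c i hlt
  exact (hmin s).not_gt (integral_haarSum_lt (by linarith) c _ hP hQ hpos hpt)

/-- If the `L_q` norm of a Haar polynomial cannot be decreased by changing the coefficient of index
`i`, then this coefficient is dominated by those of larger index. -/
theorem abs_coeff_le_of_integral_le {n : ℕ} {q : ℝ} (hq : 1 < q) (c : Fin n → ℝ) (i : Fin n)
    (hmin : ∀ s : ℝ, ∫ t, |haarSum c t| ^ q ∂volume01 ≤
      ∫ t, |haarSum (c + Pi.single i s) t| ^ q ∂volume01) :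
    |c i| ≤ ∑ j ∈ Finset.Ioi i, |c j| := by
  refine abs_le'.2 ⟨coeff_le_of_integral_le hq c i hmin, ?_⟩
  have := coeff_le_of_integral_le hq (-c) i fun s => by
    have h := hmin (-s)
    have e : -c + Pi.single i s = -(c + Pi.single i (-s)) := by
      rw [Pi.single_neg]; abel
    simpa only [e, haarSum_neg, abs_neg] using h
  simpa using this

/-- Back substitution from the largest index, whose sum is empty. -/
theorem eq_zero_of_abs_le_sum_Ioi {n : ℕ} {c : Fin n → ℝ}
    (h : ∀ i, |c i| ≤ ∑ j ∈ Finset.Ioi i, |c j|) : c = 0 := by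
  have : ∀ r : ℕ, ∀ i : Fin n, n ≤ i + r → c i = 0 := by
    intro r
    induction r with
    | zero => intro i hi; omega
    | succ r ih =>
      intro i hi
      have h0 : ∑ j ∈ Finset.Ioi i, |c j| = 0 :=
        Finset.sum_eq_zero fun j hj => by
          have := Fin.lt_def.1 (Finset.mem_Ioi.1 hj)
          rw [ih j (by omega), abs_zero]
      exact abs_nonpos_iff.1 (h0 ▸ h i)
  exact funext fun i => this n i (by omega)

/-! ### Differentiability and norming functionals. -/

theorem exists_hasDerivAt_integral_abs_rpow {f h : ℝ → ℝ} (hf : Measurable f) (hh : Measurable h)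
    {C : ℝ} (hC : ∀ t, |f t| ≤ C) (hh1 : ∀ t, |h t| ≤ 1) {q : ℝ} (hq : 1 < q) :
    ∃ d, HasDerivAt (fun s : ℝ => ∫ t, |f t + s * h t| ^ q ∂volume01) d 0 := by
  refine ⟨_, (hasDerivAt_integral_of_dominated_loc_of_deriv_le (μ := volume01) (x₀ := (0 : ℝ))
    (s := Metric.ball 0 1) (F := fun s t => |f t + s * h t| ^ q)
    (F' := fun s t => q * |f t + s * h t| ^ (q - 2) * (f t + s * h t) * h t)
    (bound := fun _ => q * (C + 1) ^ (q - 1)) (Metric.ball_mem_nhds _ one_pos) ?_ ?_ ?_ ?_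
    (integrable_const _) ?_).2⟩
  · refine Filter.Eventually.of_forall fun s => Measurable.aestronglyMeasurable ?_
    exact (hf.add (hh.const_mul s)).norm.pow_const q
  · simpa using integrable_abs_rpow_of_bound hf hC (show 0 ≤ q by linarith)
  · refine Measurable.aestronglyMeasurable ?_
    have hm : Measurable fun t => f t + 0 * h t := hf.add (hh.const_mul 0)
    exact (((hm.norm.pow_const (q - 2)).const_mul q).mul hm).mul hh
  · refine Filter.Eventually.of_forall fun t s hs => ?_
    set x := f t + s * h t with hx
    have hs1 : |s| ≤ 1 := by simpa using (mem_ball_zero_iff.1 hs).le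
    have hxC : |x| ≤ C + 1 := by
      refine (abs_add_le _ _).trans (add_le_add (hC t) ?_)
      rw [abs_mul]
      exact mul_le_one₀ hs1 (abs_nonneg _) (hh1 t)
    -- The exponent `q - 2` may be negative, so `x = 0` is treated apart.
    have hpow : |x| ^ (q - 2) * |x| ≤ (C + 1) ^ (q - 1) := by
      rcases eq_or_ne x 0 with h0 | h0
      · rw [h0, abs_zero, mul_zero]
        exact Real.rpow_nonneg ((abs_nonneg x).trans hxC) _
      · rw [← Real.rpow_add_one (abs_ne_zero.2 h0), show q - 2 + 1 = q - 1 by ring]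
        exact Real.rpow_le_rpow (abs_nonneg _) hxC (by linarith)
    have hq0 : 0 ≤ q := by linarith
    rw [Real.norm_eq_abs, abs_mul, abs_mul, abs_mul, abs_of_nonneg hq0,
      abs_of_nonneg (Real.rpow_nonneg (abs_nonneg x) _), mul_assoc q]
    refine (mul_le_of_le_one_right (by positivity) (hh1 t)).trans ?_
    gcongr
  · refine Filter.Eventually.of_forall fun t s _ => ?_
    have h1 : HasDerivAt (fun s : ℝ => f t + s * h t) (h t) s := by
      simpa using ((hasDerivAt_id s).mul_const (h t)).const_add (f t)
    exact (hasDerivAt_abs_rpow (f t + s * h t) hq).comp s h1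

/-- A norming functional of `y` vanishes in each direction in which `y` has a minimal norm and a
power of the norm is differentiable. -/
theorem IsNormingFunctional.apply_eq_zero {X : Type*} [NormedAddCommGroup X] [NormedSpace ℝ X]
    {F : X →L[ℝ] ℝ} {y v : X} (hF : IsNormingFunctional F y) (hy : y ≠ 0) {q : ℝ} (hq : 1 < q)
    (hmin : ∀ s : ℝ, ‖y‖ ≤ ‖y + s • v‖)
    (hdiff : ∃ d, HasDerivAt (fun s : ℝ => ‖y + s • v‖ ^ q) d 0) : F v = 0 := by
  obtain ⟨d, hd⟩ := hdiff
  have hq0 : 0 ≤ q := by linarith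
  have hy0 : 0 < ‖y‖ := norm_pos_iff.2 hy
  have hd0 : d = 0 := by
    refine IsLocalMin.hasDerivAt_eq_zero (Filter.Eventually.of_forall fun s => ?_) hd
    simpa using Real.rpow_le_rpow (norm_nonneg _) (hmin s) hq0
  have hlin : HasDerivAt (fun s : ℝ => ‖y‖ + s * F v) (F v) 0 := by
    simpa using ((hasDerivAt_id (0 : ℝ)).mul_const (F v)).const_add ‖y‖
  have hpow := (Real.hasDerivAt_rpow_const (x := ‖y‖ + 0 * F v) (p := q)
    (Or.inr hq.le)).comp (0 : ℝ) hlin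
  -- The norm lies above its supporting line `‖y‖ + s * F v`, with equality at `s = 0`. Comparing
  -- derivatives of `q`-th powers gives `q * ‖y‖ ^ (q - 1) * F v = 0`.
  have hmin2 : IsLocalMin (fun s : ℝ => ‖y + s • v‖ ^ q - (‖y‖ + s * F v) ^ q) 0 := by
    have hev : ∀ᶠ s : ℝ in nhds 0, 0 < ‖y‖ + s * F v :=
      hlin.continuousAt.eventually (lt_mem_nhds (by simpa using hy0))
    filter_upwards [hev] with s hs
    have : ‖y‖ + s * F v ≤ ‖y + s • v‖ := by
      have := F.le_opNorm (y + s • v)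
      rw [hF.1, one_mul, map_add, map_smul, hF.2, smul_eq_mul] at this
      exact (le_abs_self _).trans this
    simpa using Real.rpow_le_rpow hs.le this hq0
  have h := hmin2.hasDerivAt_eq_zero (hd.sub hpow)
  have hne : q * ‖y‖ ^ (q - 1) ≠ 0 := (mul_pos (by linarith) (Real.rpow_pos_of_pos hy0 _)).ne'
  simp only [hd0, zero_mul, add_zero, zero_sub, neg_eq_zero] at h
  exact (mul_eq_zero.1 h).resolve_left (by simpa using hne)

/-! ### Haar polynomials in `L_p` -/

theorem memLp_haarSum (p : ℝ≥0∞) {n : ℕ} (c : Fin n → ℝ) : MemLp (haarSum c) p volume01 :=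
  MemLp.of_bound (measurable_haarSum c).aestronglyMeasurable _
    (Filter.Eventually.of_forall (abs_haarSum_le c))

/-- The linear map sending coefficients to the corresponding Haar polynomial in `L_p[0,1]`. -/
noncomputable def haarMap (p : ℝ≥0∞) (n : ℕ) : (Fin n → ℝ) →ₗ[ℝ] Lp ℝ p volume01 where
  toFun c := (memLp_haarSum p c).toLp (haarSum c)
  map_add' c d := by
    rw [← MemLp.toLp_add]
    congr 1
    ext t
    simp [haarSum, add_mul, Finset.sum_add_distrib]
  map_smul' r c := by
    rw [RingHom.id_apply, ← MemLp.toLp_const_smul]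
    congr 1
    ext t
    simp [haarSum, Finset.mul_sum, mul_assoc]

theorem haarMap_single (p : ℝ≥0∞) {n : ℕ} (i : Fin n) :
    haarMap p n (Pi.single i 1) = (memLp_haarFun p i).toLp (haarFun i) := by
  change (memLp_haarSum p _).toLp (haarSum _) = _
  congr 1
  ext t
  simp [haarSum, Pi.single_apply]

theorem haarMap_add_single (p : ℝ≥0∞) {n : ℕ} (c : Fin n → ℝ) (i : Fin n) (s : ℝ) :
    haarMap p n (c + Pi.single i s) =
      haarMap p n c + s • (memLp_haarFun p i).toLp (haarFun i) := by
  rw [map_add, ← haarMap_single, ← map_smul, ← Pi.single_smul, smul_eq_mul, mul_one]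

section

variable {p : ℝ≥0∞}

theorem one_lt_toReal_of_one_lt (hp1 : 1 < p) (hp : p < ∞) : 1 < p.toReal := by
  simpa using (ENNReal.toReal_lt_toReal ENNReal.one_ne_top hp.ne).2 hp1

theorem norm_haarMap_rpow (hp1 : 1 < p) (hp : p < ∞) {n : ℕ} (c : Fin n → ℝ) :
    ‖haarMap p n c‖ ^ p.toReal = ∫ t, |haarSum c t| ^ p.toReal ∂volume01 := by
  have hq : 0 < p.toReal := one_pos.trans (one_lt_toReal_of_one_lt hp1 hp)
  have h0 : 0 ≤ ∫ t, |haarSum c t| ^ p.toReal ∂volume01 :=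
    integral_nonneg fun t => Real.rpow_nonneg (abs_nonneg _) _
  change ‖(memLp_haarSum p c).toLp (haarSum c)‖ ^ p.toReal = _
  rw [Lp.norm_toLp, (memLp_haarSum p c).eLpNorm_eq_integral_rpow_norm (one_pos.trans hp1).ne' hp.ne]
  simp only [Real.norm_eq_abs]
  rw [ENNReal.toReal_ofReal (Real.rpow_nonneg h0 _), ← Real.rpow_mul h0, inv_mul_cancel₀ hq.ne',
    Real.rpow_one]

variable [Fact (1 ≤ p)]

theorem abs_coeff_le_of_norm_le (hp1 : 1 < p) (hp : p < ∞) {n : ℕ} (c : Fin n → ℝ) (i : Fin n)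
    (hmin : ∀ s : ℝ, ‖haarMap p n c‖ ≤ ‖haarMap p n (c + Pi.single i s)‖) :
    |c i| ≤ ∑ j ∈ Finset.Ioi i, |c j| := by
  refine abs_coeff_le_of_integral_le (one_lt_toReal_of_one_lt hp1 hp) c i fun s => ?_
  rw [← norm_haarMap_rpow hp1 hp, ← norm_haarMap_rpow hp1 hp]
  exact Real.rpow_le_rpow (norm_nonneg _) (hmin s) ENNReal.toReal_nonneg

/-- A zero sum has minimal norm in every direction, so every coefficient is dominated by its
successors. -/
theorem haarMap_injective (hp1 : 1 < p) (hp : p < ∞) (n : ℕ) :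
    Function.Injective (haarMap p n) := by
  refine (injective_iff_map_eq_zero _).2 fun c hc => eq_zero_of_abs_le_sum_Ioi fun i => ?_
  exact abs_coeff_le_of_norm_le hp1 hp c i fun s => by simp [hc]

theorem exists_haarLp_eq_smul (hp1 : 1 < p) (hp : p < ∞) (i : ℕ) :
    ∃ r : ℝ, r ≠ 0 ∧ haarLp p i = r • (memLp_haarFun p i).toLp (haarFun i) := by
  refine ⟨_, inv_ne_zero (norm_ne_zero_iff.2 ?_), rfl⟩
  have h := haarMap_single p (Fin.last i)
  rw [Fin.val_last] at h
  rw [← h, Ne, map_eq_zero_iff _ (haarMap_injective hp1 hp _)]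
  intro h0
  simpa using congrFun h0 (Fin.last i)

theorem abs_coeff_le_of_haarLp_minimal (hp1 : 1 < p) (hp : p < ∞) {n : ℕ} (c : Fin n → ℝ)
    (i : Fin n) (hmin : ∀ s : ℝ, ‖haarMap p n c‖ ≤ ‖haarMap p n c + s • haarLp p i‖) :
    |c i| ≤ ∑ j ∈ Finset.Ioi i, |c j| := by
  obtain ⟨r, hr, he⟩ := exists_haarLp_eq_smul hp1 hp i
  refine abs_coeff_le_of_norm_le hp1 hp c i fun s => ?_
  have h := hmin (s / r)
  rwa [he, smul_smul, div_mul_cancel₀ _ hr, ← haarMap_add_single] at h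

theorem exists_hasDerivAt_norm_rpow (hp1 : 1 < p) (hp : p < ∞) {n : ℕ} (c : Fin n → ℝ)
    (i : Fin n) :
    ∃ d, HasDerivAt (fun s : ℝ => ‖haarMap p n c + s • haarLp p i‖ ^ p.toReal) d 0 := by
  obtain ⟨r, -, he⟩ := exists_haarLp_eq_smul hp1 hp i
  obtain ⟨d, hd⟩ := exists_hasDerivAt_integral_abs_rpow (measurable_haarSum c)
    (measurable_haarFun i) (abs_haarSum_le c) (norm_haarFun_le i)
    (one_lt_toReal_of_one_lt hp1 hp)
  have hfun : (fun s : ℝ => ‖haarMap p n c + s • haarLp p i‖ ^ p.toReal) =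
      (fun s : ℝ => ∫ t, |haarSum c t + s * haarFun i t| ^ p.toReal ∂volume01) ∘
        fun s => s * r := by
    ext s
    rw [he, smul_smul, ← haarMap_add_single, norm_haarMap_rpow hp1 hp]
    simp only [haarSum_add_single, Function.comp_apply]
  rw [hfun]
  exact ⟨_, HasDerivAt.comp (0 : ℝ) (by simpa using hd) (hasDerivAt_mul_const r)⟩

theorem haarSpan_le_range (hp1 : 1 < p) (hp : p < ∞) (m : ℕ) :
    haarSpan p m ≤ LinearMap.range (haarMap p (m + 1)) := by
  refine Submodule.span_le.2 ?_
  rintro _ ⟨i, hi, rfl⟩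
  obtain ⟨r, -, he⟩ := exists_haarLp_eq_smul hp1 hp i
  have h := haarMap_single p (⟨i, Nat.lt_succ_of_le hi⟩ : Fin (m + 1))
  exact ⟨r • Pi.single ⟨i, Nat.lt_succ_of_le hi⟩ 1, by rw [map_smul, h, he]⟩

end

/-! ### Greedy steps for finite dictionaries -/

section Greedy

variable {X : Type*} [NormedAddCommGroup X] [NormedSpace ℝ X]

theorem exists_minimizing_scalar (y φ : X) : ∃ a : ℝ, ∀ b : ℝ, ‖y - a • φ‖ ≤ ‖y - b • φ‖ := by
  rcases eq_or_ne φ 0 with rfl | hφ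
  · exact ⟨0, fun b => by simp⟩
  have hcont : Continuous fun a : ℝ => ‖y - a • φ‖ := by fun_prop
  refine hcont.exists_forall_le ?_
  have h1 : Filter.Tendsto (fun a : ℝ => ‖a‖ * ‖φ‖ - ‖y‖) (Filter.cocompact ℝ) Filter.atTop :=
    Filter.tendsto_atTop_add_const_right _ _
      ((tendsto_norm_cocompact_atTop (E := ℝ)).atTop_mul_const (norm_pos_iff.2 hφ))
  refine Filter.tendsto_atTop_mono (fun a => ?_) h1
  rw [← norm_smul, norm_sub_rev]
  exact norm_sub_norm_le _ _

theorem exists_greedyStep_of_selects {selects : X → X → Prop} {y φ : X} (h : selects y φ) :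
    ∃ z, GreedyStep selects y z := by
  obtain ⟨a, ha⟩ := exists_minimizing_scalar y φ
  exact ⟨_, φ, a, h, ha, rfl⟩

theorem exists_xgaSelects {D : Set X} (hD : D.Finite) (hne : D.Nonempty) (y : X) :
    ∃ φ, XGASelects D y φ := by
  choose a ha using exists_minimizing_scalar y
  obtain ⟨φ, hφ, hmin⟩ := Set.exists_min_image D (fun φ => ‖y - a φ • φ‖) hD hne
  exact ⟨φ, hφ, a φ, fun ψ hψ b => (hmin ψ hψ).trans (ha ψ b)⟩

theorem exists_dgaSelects {D : Set X} (hD : D.Finite) (hne : D.Nonempty) {y : X} (hy : y ≠ 0) :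
    ∃ φ, DGASelects D y φ := by
  obtain ⟨F, hF⟩ := exists_dual_vector ℝ y (norm_ne_zero_iff.2 hy)
  obtain ⟨φ, hφ, hmax⟩ := Set.exists_max_image D (fun φ => |F φ|) hD hne
  exact ⟨φ, hφ, F, ⟨hF.1, by simpa using hF.2⟩, hmax⟩

/-- On a compact set, strict norm reductions by multiples of `φ` can be made uniform. -/
theorem exists_uniform_reduction {W : Type*} [TopologicalSpace W] {K : Set W} (hK : IsCompact K)
    {y φ : W → X} (hy : Continuous y) (hφ : Continuous φ)
    (h : ∀ w ∈ K, ∃ b : ℝ, ‖y w - b • φ w‖ < 1) :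
    ∃ θ : ℝ, 0 ≤ θ ∧ θ < 1 ∧ ∀ w ∈ K, ∃ b : ℝ, ‖y w - b • φ w‖ ≤ θ := by
  refine hK.induction_on (p := fun S => ∃ θ : ℝ, 0 ≤ θ ∧ θ < 1 ∧
    ∀ w ∈ S, ∃ b : ℝ, ‖y w - b • φ w‖ ≤ θ) ⟨0, le_rfl, one_pos, by simp⟩ ?_ ?_ ?_
  · rintro S T hST ⟨θ, h0, h1, hθ⟩
    exact ⟨θ, h0, h1, fun w hw => hθ w (hST hw)⟩
  · rintro S T ⟨θ, h0, h1, hθ⟩ ⟨η, _, h3, hη⟩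
    refine ⟨max θ η, le_max_of_le_left h0, max_lt h1 h3, ?_⟩
    rintro w (hw | hw)
    · exact (hθ w hw).imp fun b hb => hb.trans (le_max_left _ _)
    · exact (hη w hw).imp fun b hb => hb.trans (le_max_right _ _)
  · intro w hw
    obtain ⟨b, hb⟩ := h w hw
    obtain ⟨θ, hθ1, hθ2⟩ := exists_between hb
    have hcont : Continuous fun w => ‖y w - b • φ w‖ := by fun_prop
    -- The scalar `b` found at `w` still works, with bound `θ`, on a neighbourhood of `w`.
    exact ⟨_, mem_nhdsWithin_of_mem_nhds (hcont.continuousAt.eventually (gt_mem_nhds hθ1)), θ,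
      (norm_nonneg _).trans hθ1.le, hθ2, fun w hw => ⟨b, le_of_lt hw⟩⟩

/-- If norming functionals detect the directions of decrease of the norm, then the steps of the dual
greedy algorithm reduce the norm by a uniform factor. -/
theorem exists_dga_contraction [FiniteDimensional ℝ X] {D : Set X} (hD : D.Finite)
    (htotal : ∀ F : X →L[ℝ] ℝ, (∀ ψ ∈ D, F ψ = 0) → F = 0)
    (hdec : ∀ y : X, y ≠ 0 → ∀ F, IsNormingFunctional F y → ∀ φ ∈ D, F φ ≠ 0 →
      ∃ b : ℝ, ‖y - b • φ‖ < ‖y‖) :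
    ∃ θ : ℝ, 0 ≤ θ ∧ θ < 1 ∧
      ∀ y φ : X, y ≠ 0 → DGASelects D y φ → ∃ b : ℝ, ‖y - b • φ‖ ≤ θ * ‖y‖ := by
  have := FiniteDimensional.proper ℝ X
  have := FiniteDimensional.proper ℝ (X →L[ℝ] ℝ)
  -- Admissible DGA selections at unit vectors, as triples (vector, norming functional, selected
  -- element); all the conditions are closed.
  let K : Set (X × (X →L[ℝ] ℝ) × X) :=
    (Metric.sphere 0 1 ×ˢ Metric.sphere 0 1 ×ˢ D) ∩
      ({w | w.2.1 w.1 = ‖w.1‖} ∩ ⋂ ψ ∈ D, {w | |w.2.1 ψ| ≤ |w.2.1 w.2.2|})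
  have hK : IsCompact K := by
    refine ((isCompact_sphere _ _).prod ((isCompact_sphere _ _).prod hD.isCompact)).inter_right ?_
    refine (isClosed_eq (by fun_prop) (by fun_prop)).inter (isClosed_biInter fun ψ _ => ?_)
    exact isClosed_le (by fun_prop) (by fun_prop)
  obtain ⟨θ, h0, h1, hθ⟩ := exists_uniform_reduction hK (y := fun w => w.1) (φ := fun w => w.2.2)
    (by fun_prop) (by fun_prop) (by
      rintro ⟨y, F, φ⟩ ⟨⟨hy, hF, hφ⟩, hFy, hmax⟩
      have hy1 : ‖y‖ = 1 := mem_sphere_zero_iff_norm.1 hy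
      have hF1 : ‖F‖ = 1 := mem_sphere_zero_iff_norm.1 hF
      -- If the maximum of `|F ψ|` were `0`, then `F` would vanish on the dictionary.
      have hFφ : F φ ≠ 0 := fun h => by
        have : F = 0 := htotal F fun ψ hψ => by
          have := Set.mem_iInter₂.1 hmax ψ hψ
          simpa [h] using this
        simp [this] at hF1
      simpa [hy1] using hdec y (norm_ne_zero_iff.1 (by simp [hy1])) F ⟨hF1, hFy⟩ φ hφ hFφ)
  refine ⟨θ, h0, h1, fun y φ hy ⟨hφ, F, hF, hmax⟩ => ?_⟩
  have hy0 : ‖y‖ ≠ 0 := norm_ne_zero_iff.2 hy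
  have hy1 : ‖(‖y‖⁻¹ • y)‖ = 1 := by rw [norm_smul, norm_inv, norm_norm, inv_mul_cancel₀ hy0]
  obtain ⟨b, hb⟩ := hθ (‖y‖⁻¹ • y, F, φ)
    ⟨⟨mem_sphere_zero_iff_norm.2 hy1, mem_sphere_zero_iff_norm.2 hF.1, hφ⟩,
      by simp only [Set.mem_ofPred_eq]; rw [map_smul, hF.2, hy1, smul_eq_mul, inv_mul_cancel₀ hy0],
      Set.mem_iInter₂.2 hmax⟩
  refine ⟨‖y‖ * b, ?_⟩
  have e : y - (‖y‖ * b) • φ = ‖y‖ • (‖y‖⁻¹ • y - b • φ) := by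
    rw [smul_sub, smul_smul, smul_smul, mul_inv_cancel₀ hy0, one_smul]
  rw [e, norm_smul, norm_norm, mul_comm]
  exact mul_le_mul_of_nonneg_right hb (norm_nonneg y)

theorem TerminatesWithin.mono {selects : X → X → Prop} {N N' : ℕ} (hN : N ≤ N') {x₀ : X}
    (h : TerminatesWithin selects N x₀) : TerminatesWithin selects N' x₀ :=
  fun n x hx => ⟨(h n x hx).1.trans hN, (h n x hx).2⟩

end Greedy

/-! ### Termination for the Haar dictionary -/

section

variable {p : ℝ≥0∞} [Fact (1 ≤ p)]

instance finiteDimensional_haarSpan (p : ℝ≥0∞) [Fact (1 ≤ p)] (m : ℕ) :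
    FiniteDimensional ℝ (haarSpan p m) :=
  FiniteDimensional.span_of_finite ℝ ((Set.finite_Iic m).image _)

theorem haarDictionary_finite (p : ℝ≥0∞) [Fact (1 ≤ p)] (m : ℕ) : (haarDictionary p m).Finite := by
  have : haarDictionary p m = Subtype.val ⁻¹' (haarLp p '' Set.Iic m) := by
    ext φ
    simp only [haarDictionary, Set.mem_ofPred_eq, Set.mem_preimage, Set.mem_image, Set.mem_Iic]
    exact exists_congr fun i => and_congr_right fun _ => eq_comm
  rw [this]
  exact ((Set.finite_Iic m).image _).preimage Subtype.val_injective.injOn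

theorem haarLp_mem_haarSpan (p : ℝ≥0∞) {m i : ℕ} (hi : i ≤ m) : haarLp p i ∈ haarSpan p m :=
  Submodule.subset_span ⟨i, hi, rfl⟩

theorem haarDictionary_nonempty (p : ℝ≥0∞) (m : ℕ) : (haarDictionary p m).Nonempty :=
  ⟨⟨_, haarLp_mem_haarSpan p (Nat.zero_le m)⟩, 0, Nat.zero_le m, rfl⟩

theorem haarDictionary_total {m : ℕ} (F : haarSpan p m →L[ℝ] ℝ)
    (hF : ∀ ψ ∈ haarDictionary p m, F ψ = 0) : F = 0 := by
  ext ⟨x, hx⟩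
  rw [zero_apply]
  induction hx using Submodule.span_induction with
  | mem x h =>
    obtain ⟨i, hi, rfl⟩ := h
    exact hF _ ⟨i, hi, rfl⟩
  | zero => exact map_zero F
  | add x y hx hy h1 h2 =>
    have := map_add F ⟨x, hx⟩ ⟨y, hy⟩
    rw [h1, h2, add_zero] at this
    exact this
  | smul a x hx h =>
    have := map_smul F a ⟨x, hx⟩
    rw [h, smul_zero] at this
    exact this

/-- Without a decrease `y` would be minimal along `φ`, and differentiability there would force `F φ
= 0`. -/
theorem exists_norm_sub_lt_of_apply_ne_zero (hp1 : 1 < p) (hp : p < ∞) {m : ℕ}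
    {y : haarSpan p m} (hy : y ≠ 0) {F : haarSpan p m →L[ℝ] ℝ} (hF : IsNormingFunctional F y)
    {φ : haarSpan p m} (hφ : φ ∈ haarDictionary p m) (hFφ : F φ ≠ 0) :
    ∃ b : ℝ, ‖y - b • φ‖ < ‖y‖ := by
  by_contra! hmin
  obtain ⟨i, hi, hφi⟩ := hφ
  obtain ⟨c, hc⟩ := haarSpan_le_range hp1 hp m y.2
  refine hFφ (hF.apply_eq_zero hy (one_lt_toReal_of_one_lt hp1 hp) (fun s => ?_) ?_)
  · simpa using hmin (-s)
  · have h := exists_hasDerivAt_norm_rpow hp1 hp c ⟨i, Nat.lt_succ_of_le hi⟩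
    rw [hc] at h
    simpa only [Submodule.coe_norm, Submodule.coe_add, Submodule.coe_smul, hφi] using h

/-- The coefficients of a greedy run with respect to the unnormalized Haar functions form a
triangular run with `s` the norm of the residual, so only the contraction depends on the selection
rule. -/
theorem exists_terminatesWithin (hp1 : 1 < p) (hp : p < ∞) {m : ℕ}
    {selects : haarSpan p m → haarSpan p m → Prop}
    (hsel : ∀ y φ, selects y φ → φ ∈ haarDictionary p m)
    (hex : ∀ y, y ≠ 0 → ∃ φ, selects y φ) {θ : ℝ} (hθ0 : 0 ≤ θ) (hθ1 : θ < 1)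
    (hcontr : ∀ y z, y ≠ 0 → GreedyStep selects y z → ‖z‖ ≤ θ * ‖y‖) :
    ∃ N, ∀ x₀, TerminatesWithin selects N x₀ := by
  obtain ⟨A, hA, hanti⟩ := (haarMap p (m + 1)).exists_antilipschitzWith
    (LinearMap.ker_eq_bot.2 (haarMap_injective hp1 hp _))
  have hA0 : (0 : ℝ) < A := hA
  obtain ⟨N, hN⟩ := IsTriangularRun.exists_length_le (fun c => ‖haarMap p (m + 1) c‖) hθ0 hθ1
    (inv_pos.2 hA0) (norm_nonneg (LinearMap.toContinuousLinearMap (haarMap p (m + 1))))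
    (fun v => by
      rw [inv_mul_le_iff₀ hA0]
      simpa using hanti.le_mul_dist v 0)
    (fun v => (LinearMap.toContinuousLinearMap (haarMap p (m + 1))).le_opNorm v) (m + 1)
  refine ⟨N, fun x₀ n x hx => ⟨?_, fun h => ?_⟩⟩
  swap
  · obtain ⟨φ, hφ⟩ := hex _ h
    exact exists_greedyStep_of_selects hφ
  have hc : ∀ t, ∃ c, haarMap p (m + 1) c = x t := fun t => haarSpan_le_range hp1 hp m (x t).2
  choose c hc using hc
  have hpick : ∀ t, ∃ i : Fin (m + 1), t < n →
      (∀ j, j ≠ i → c (t + 1) j = c t j) ∧ |c (t + 1) i| ≤ ∑ j ∈ Finset.Ioi i, |c (t + 1) j| := by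
    intro t
    by_cases ht : t < n
    swap
    · exact ⟨0, fun h => absurd h ht⟩
    obtain ⟨-, φ, a, hφ, hmin, hz⟩ := hx.2 t ht
    obtain ⟨i, hi, hφi⟩ := hsel _ _ hφ
    obtain ⟨r, -, hr⟩ := exists_haarLp_eq_smul hp1 hp i
    refine ⟨⟨i, Nat.lt_succ_of_le hi⟩, fun _ => ⟨fun j hj => ?_, ?_⟩⟩
    · have hcc : c (t + 1) = c t + Pi.single ⟨i, Nat.lt_succ_of_le hi⟩ (-(a * r)) := by
        apply haarMap_injective hp1 hp
        rw [haarMap_add_single, hc, hc, hz, Submodule.coe_sub, Submodule.coe_smul, hφi, hr,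
          smul_smul, neg_smul, sub_eq_add_neg]
      rw [hcc, Pi.add_apply, Pi.single_eq_of_ne hj, add_zero]
    · refine abs_coeff_le_of_haarLp_minimal hp1 hp _ _ fun s => ?_
      -- The new residual is minimal along `φ`, since `y - (a - s) • φ` is that residual plus `s •
      -- φ`.
      have h := hmin (a - s)
      rw [← hz, sub_smul, ← sub_add, sub_add_eq_add_sub, ← sub_add_eq_add_sub, ← hz] at h
      rw [hc, ← hφi]
      exact h
  choose pick hpick using hpick
  refine hN Finset.univ n c pick (by simp) ⟨fun t _ => Finset.mem_univ _,
    fun t ht => (hpick t ht).1, fun t ht => (hpick t ht).2, fun t ht => ?_, fun t ht => ?_⟩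
  · simp only [hc]
    exact hcontr _ _ (hx.2 t ht).1 (hx.2 t ht).2
  · simp only [hc]
    exact norm_pos_iff.2 (by simpa using (hx.2 t ht).1)

end

theorem mainTheorem2 (p : ℝ≥0∞) [Fact (1 ≤ p)] (hp_one : 1 < p) (hp_top : p < ∞) (m : ℕ) :
    ∃ N : ℕ, 0 < N ∧ ∀ x₀ : haarSpan p m,
      TerminatesWithin (XGASelects (haarDictionary p m)) N x₀ ∧
      TerminatesWithin (DGASelects (haarDictionary p m)) N x₀ := by
  have hfin := haarDictionary_finite p m
  have hne := haarDictionary_nonempty p m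
  obtain ⟨θ, hθ0, hθ1, hθ⟩ := exists_dga_contraction hfin haarDictionary_total
    fun y hy F hF φ hφ => exists_norm_sub_lt_of_apply_ne_zero hp_one hp_top hy hF hφ
  obtain ⟨N₁, hN₁⟩ := exists_terminatesWithin hp_one hp_top
    (selects := XGASelects (haarDictionary p m)) (fun y φ h => h.1)
    (fun y _ => exists_xgaSelects hfin hne y) hθ0 hθ1 (by
      rintro y z hy ⟨φ, a, ⟨-, a', ha'⟩, hmin, rfl⟩
      -- The XGA step reduces the norm at least as much as any step along an element the DGA could
      -- select.
      obtain ⟨ψ, hψ⟩ := exists_dgaSelects hfin hne hy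
      obtain ⟨b, hb⟩ := hθ y ψ hy hψ
      exact ((hmin a').trans (ha' ψ hψ.1 b)).trans hb)
  obtain ⟨N₂, hN₂⟩ := exists_terminatesWithin hp_one hp_top
    (selects := DGASelects (haarDictionary p m)) (fun y φ h => h.1)
    (fun y hy => exists_dgaSelects hfin hne hy) hθ0 hθ1 (by
      rintro y z hy ⟨φ, a, hφ, hmin, rfl⟩
      obtain ⟨b, hb⟩ := hθ y φ hy hφ
      exact (hmin b).trans hb)
  exact ⟨N₁ + N₂ + 1, by omega, fun x₀ => ⟨(hN₁ x₀).mono (by omega), (hN₂ x₀).mono (by omega)⟩⟩
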